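/- Let $\Gamma$ be a compact connected metric graph, with finitely many vertices (a set $\mathcal V$, $V=|\mathcal V|$) and finitely many edges (a set $\mathcal E$, $E=|\mathcal E|\ge 1$), each edge $e$ being identified with an interval $[0,L(e)]$, $0<L(e)<\infty$, and equip $\Gamma$ with its natural (shortest path) distance. Let $-\Delta_\Gamma$ be the Laplacian on $\Gamma$ with standard vertex conditions: it acts as $f_e\mapsto -f_e''$ on each edge $e$, on the real-valued functions $f$ which are continuous on $\Gamma$, have $f_e\in H^2(0,L(e))$ for every edge $e$, and for which at every vertex the derivatives of $f$ in the direction towards the vertex, taken along all incident edges, add up to zero. Let $\mu_2(\Gamma)$ be its smallest positive eigenvalue, and put $$M=\Big\{x\in\Gamma:\ \text{there is an eigenfunction } \psi \text{ for } \mu_2(\Gamma) \text{ with } \psi(x)=\max_{y\in\Gamma}\psi(y)\Big\},$$ $$M_{\mathrm{loc}}=\Big\{x\in\Gamma:\ \text{there are an eigenfunction } \psi \text{ for } \mu_2(\Gamma) \text{ and } \varepsilon>0 \text{ with } 0\neq\psi(x)=\max_{\operatorname{dist}(x,y)<\varepsilon}\psi(y)\Big\}.$$ Suppose that $\Gamma$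 is equilateral, i.e. all edges have the same length, and that one of the following holds: 1. $\Gamma$ is a pumpkin graph with $E\ge 2$, i.e. $\Gamma$ has exactly two vertices and at least two edges, and each edge connects one vertex with the other; 2. $\Gamma$ is a complete graph with $V\ge 3$, i.e. any two distinct vertices are connected by exactly one edge, and there are no loops. Then $M=M_{\mathrm{loc}}=\Gamma$. -/

import Mathlib

open Set MeasureTheory

/-- A compact connected metric graph: finitely many vertices `V`, finitely many edges `E` (parallel
edges and loops are allowed, and there is at least one edge), every edge `e` running from the vertex
`src e` to the vertex `tgt e` and carrying a length in `(0, ∞)`. -/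
structure MetricGraph (V E : Type*) [Fintype V] [Fintype E] where
  src : E → V
  tgt : E → V
  length : E → ℝ
  length_pos : ∀ e, 0 < length e
  nonempty_edges : Nonempty E
  connected : ∀ u v : V, Relation.EqvGen (fun a b => ∃ e, src e = a ∧ tgt e = b) u v

namespace MetricGraph

variable {V E : Type*} [Fintype V] [Fintype E] (Γ : MetricGraph V E)

/-- The disjoint union of the intervals `[0, length e]`. -/
abbrev PrePoint : Type _ := Σ e : E, Icc (0 : ℝ) (Γ.length e)

/-- The point of the disjoint union is an endpoint of its edge, lying at the vertex `v`. -/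
def IsAt (p : Γ.PrePoint) (v : V) : Prop :=
  ((p.2 : ℝ) = 0 ∧ Γ.src p.1 = v) ∨ ((p.2 : ℝ) = Γ.length p.1 ∧ Γ.tgt p.1 = v)

/-- The metric graph as a set of points: the disjoint union of the edges `[0, length e]`, in which
all endpoints that lie at one and the same vertex are identified. -/
def Point : Type _ := Quot (fun p q : Γ.PrePoint => ∃ v, Γ.IsAt p v ∧ Γ.IsAt q v)

/-- The point with coordinate `x` on the edge `e`. -/
def pt (e : E) (x : Icc (0 : ℝ) (Γ.length e)) : Γ.Point := Quot.mk _ ⟨e, x⟩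

/-- `Γ.IsChain x y r`: one can go from `x` to `y` by finitely many moves, each inside one edge, the
lengths of which add up to `r`. -/
inductive IsChain : Γ.Point → Γ.Point → ℝ → Prop
  | refl (x : Γ.Point) : IsChain x x 0
  | step {x : Γ.Point} {r : ℝ} (e : E) (s t : Icc (0 : ℝ) (Γ.length e)) :
      IsChain x (Γ.pt e s) r → IsChain x (Γ.pt e t) (r + |(s : ℝ) - t|)

/-- The natural (shortest path) distance on the metric graph. -/
noncomputable def pdist (x y : Γ.Point) : ℝ := sInf {r | Γ.IsChain x y r}

/-- The restriction `f_e` of a function on the graph to the edge `e`, as a function on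
`[0, length e]` (extended by constants to the real line). -/
noncomputable def onEdge (f : Γ.Point → ℝ) (e : E) : ℝ → ℝ :=
  IccExtend (Γ.length_pos e).le (fun x => f (Γ.pt e x))

/-- `f` is (the continuous representative of) a function in the Sobolev space `H¹(0, ℓ)`, with weak
derivative `g ∈ L²(0, ℓ)`: it is absolutely continuous, namely a primitive of `g`. -/
def HasSobolevDeriv (ℓ : ℝ) (f g : ℝ → ℝ) : Prop :=
  MemLp g 2 (volume.restrict (Icc 0 ℓ)) ∧ ∀ x ∈ Icc 0 ℓ, f x = f 0 + ∫ s in (0 : ℝ)..x, g s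

open Classical in
/-- `f` belongs to the domain of the Laplacian with standard (continuity and Kirchhoff) vertex
conditions, with first derivatives `f_e' = p e` and second derivatives `f_e'' = h e ∈ L²`. So
`f_e ∈ H²(0, length e)` for all edges, `p e` being the continuous representative of `f_e'`, and at
every vertex the derivatives in the direction towards the vertex add up to zero. The continuity of
`f` at the vertices is automatic, `f` being a function on the glued space. -/
def InLaplacianDomain (f : Γ.Point → ℝ) (p h : E → ℝ → ℝ) : Prop :=
  (∀ e, HasSobolevDeriv (Γ.length e) (Γ.onEdge f e) (p e)) ∧
  (∀ e, HasSobolevDeriv (Γ.length e) (p e) (h e)) ∧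
  ∀ v : V, (∑ e with Γ.tgt e = v, p e (Γ.length e)) - (∑ e with Γ.src e = v, p e 0) = 0

/-- `f` is a (real-valued) eigenfunction of the standard Laplacian `-Δ` for the eigenvalue `μ`. -/
def IsEigenfunction (μ : ℝ) (f : Γ.Point → ℝ) : Prop :=
  f ≠ 0 ∧ ∃ p h : E → ℝ → ℝ, Γ.InLaplacianDomain f p h ∧
    ∀ e, ∀ᵐ x ∂(volume.restrict (Icc 0 (Γ.length e))), -(h e x) = μ * Γ.onEdge f e x

/-- `μ` is the smallest positive eigenvalue `μ₂(Γ)` of the standard Laplacian. (The graph being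
connected, `0` is a simple eigenvalue, so that this is the second one, counted with
multiplicities.) -/
def IsMuTwo (μ : ℝ) : Prop :=
  IsLeast {lam : ℝ | 0 < lam ∧ ∃ f, Γ.IsEigenfunction lam f} μ

/-- The set `M` of (global) hot spots. -/
def hotSpots : Set Γ.Point :=
  {x | ∃ μ ψ, Γ.IsMuTwo μ ∧ Γ.IsEigenfunction μ ψ ∧ ∀ y, ψ y ≤ ψ x}

/-- The set `M_loc` of local hot spots. -/
def localHotSpots : Set Γ.Point :=
  {x | ∃ μ ψ, Γ.IsMuTwo μ ∧ Γ.IsEigenfunction μ ψ ∧ ψ x ≠ 0 ∧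
    ∃ ε > 0, ∀ y, Γ.pdist x y < ε → ψ y ≤ ψ x}

/-- All edges have the same length. -/
def IsEquilateral : Prop := ∃ ℓ : ℝ, ∀ e, Γ.length e = ℓ

/-- The edge `e` connects `u` and `v`, in one direction or the other. -/
def Connects (e : E) (u v : V) : Prop :=
  (Γ.src e = u ∧ Γ.tgt e = v) ∨ (Γ.src e = v ∧ Γ.tgt e = u)

/-- Pumpkin graph: there are exactly two vertices, and every edge connects one with the other. -/
def IsPumpkin : Prop :=
  ∃ v₁ v₂ : V, v₁ ≠ v₂ ∧ (∀ v, v = v₁ ∨ v = v₂) ∧ ∀ e, Γ.Connects e v₁ v₂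

/-- Complete graph: any two distinct vertices are connected by exactly one edge, and there are no
loops (so that every vertex has degree `|V| - 1`). -/
def IsComplete : Prop :=
  (∀ u v : V, u ≠ v → ∃! e, Γ.Connects e u v) ∧ ∀ e, Γ.src e ≠ Γ.tgt e

end MetricGraph

/-! Every edge has length `ℓ`, and an eigenfunction for `k²` is `A cos (k x) + B sin (k x)` on each
edge. For `0 < k ℓ < π` it is determined by its vertex values, which satisfy a discrete equation
(`IsEigenfunction.exists_discrete`). That equation has only the zero solution when `k ℓ < θ`, where
`θ = π` for a pumpkin and `cos θ = -1/(V-1)` for a complete graph. At `k ℓ = θ` there is enough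
freedom to prescribe the eigenfunction as `cos (k (x - t))` on a chosen edge, peaking at the chosen
point `t` with value 1. The rest is filled in as evenly as possible, so that the amplitude satisfies
`A² + B² ≤ 1` on every other edge. The peak is then a global maximum. These eigenfunctions also show
that `(θ/ℓ)²` is an eigenvalue, hence equal to `μ₂`. -/

namespace MetricGraph

/-! ### Sobolev functions on a single edge. -/

/-- A continuously differentiable function is a primitive of its derivative in the Sobolev sense. -/
lemma HasSobolevDeriv.of_hasDerivAt {ℓ : ℝ} (hℓ : 0 ≤ ℓ) {f φ g : ℝ → ℝ} (hg : Continuous g)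
    (hφ : ∀ x, HasDerivAt φ (g x) x) (hf : ∀ x ∈ Icc 0 ℓ, f x = φ x) :
    HasSobolevDeriv ℓ f g := by
  constructor
  · obtain ⟨C, hC⟩ := isCompact_Icc.exists_bound_of_continuousOn (hg.continuousOn (s := Icc 0 ℓ))
    exact MemLp.of_bound hg.aestronglyMeasurable C
      ((ae_restrict_iff' measurableSet_Icc).2 (Filter.Eventually.of_forall hC))
  · intro x hx
    rw [intervalIntegral.integral_eq_sub_of_hasDerivAt (fun y _ => hφ y)
      (hg.intervalIntegrable _ _), hf x hx, hf 0 ⟨le_rfl, hℓ⟩]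
    ring

lemma HasSobolevDeriv.continuousOn {ℓ : ℝ} {f g : ℝ → ℝ} (h : HasSobolevDeriv ℓ f g) :
    ContinuousOn f (Icc 0 ℓ) := by
  have hint : IntegrableOn g (Icc 0 ℓ) := h.1.integrable (by norm_num)
  have := intervalIntegral.continuousOn_primitive_Icc hint
  refine ContinuousOn.congr (f := fun x => f 0 + ∫ s in Icc 0 x, g s)
    (continuousOn_const.add this) fun x hx => ?_
  simp only [h.2 x hx, intervalIntegral.integral_of_le hx.1, integral_Icc_eq_integral_Ioc]

/-- Solutions of `-f'' = k² f` in `H²(0, ℓ)` are combinations of `cos (k x)` and `sin (k x)`. -/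
lemma HasSobolevDeriv.eq_cos_add_sin {ℓ k : ℝ} (hℓ : 0 < ℓ) (hk : 0 < k) {f p h : ℝ → ℝ}
    (hfp : HasSobolevDeriv ℓ f p) (hph : HasSobolevDeriv ℓ p h)
    (heq : ∀ᵐ x ∂(volume.restrict (Icc 0 ℓ)), -(h x) = k ^ 2 * f x) :
    ∀ x ∈ Icc 0 ℓ, f x = f 0 * Real.cos (k * x) + p 0 / k * Real.sin (k * x) ∧
      p x = p 0 * Real.cos (k * x) - k * f 0 * Real.sin (k * x) := by
  -- Regularity bootstrap: `P` and `G` agree with `p` and `f` on the edge, but are differentiable on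
  -- the whole line because `F` is continuous.
  set F : ℝ → ℝ := IccExtend hℓ.le (fun x : Icc (0 : ℝ) ℓ => f x)
  have hFc : Continuous F := (continuousOn_iff_continuous_domRestrict.1 hfp.continuousOn).Icc_extend'
  have hFf : ∀ x ∈ Icc 0 ℓ, F x = f x := fun x hx => IccExtend_of_mem hℓ.le _ hx
  set P : ℝ → ℝ := fun x => p 0 + ∫ s in (0 : ℝ)..x, -(k ^ 2 * F s)
  have hPd : ∀ x, HasDerivAt P (-(k ^ 2 * F x)) x := fun x =>
    (Continuous.integral_hasStrictDerivAt (by fun_prop) 0 x).hasDerivAt.const_add _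
  have hPc : Continuous P := continuous_iff_continuousAt.2 fun x => (hPd x).continuousAt
  have hPp : ∀ x ∈ Icc 0 ℓ, P x = p x := by
    intro x hx
    rw [hph.2 x hx]
    refine congrArg (p 0 + ·) (intervalIntegral.integral_congr_ae ?_)
    filter_upwards [(ae_restrict_iff' measurableSet_Icc).1 heq] with s hs hsx
    rw [uIoc_of_le hx.1] at hsx
    have hs' : s ∈ Icc 0 ℓ := ⟨hsx.1.le, hsx.2.trans hx.2⟩
    rw [hFf s hs', ← hs hs', neg_neg]
  set G : ℝ → ℝ := fun x => f 0 + ∫ s in (0 : ℝ)..x, P s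
  have hGd : ∀ x, HasDerivAt G (P x) x := fun x =>
    (Continuous.integral_hasStrictDerivAt hPc 0 x).hasDerivAt.const_add _
  have hGf : ∀ x ∈ Icc 0 ℓ, G x = f x := by
    intro x hx
    rw [hfp.2 x hx]
    refine congrArg (f 0 + ·) (intervalIntegral.integral_congr fun s hs => ?_)
    rw [uIcc_of_le hx.1] at hs
    exact hPp s ⟨hs.1, hs.2.trans hx.2⟩
  have hlin : ∀ x, HasDerivAt (fun y => k * y) k x := fun x => by
    simpa using (hasDerivAt_id x).const_mul k
  have hcos : ∀ x, HasDerivAt (fun y => Real.cos (k * y)) (-Real.sin (k * x) * k) x :=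
    fun x => (hlin x).cos
  have hsin : ∀ x, HasDerivAt (fun y => Real.sin (k * y)) (Real.cos (k * x) * k) x :=
    fun x => (hlin x).sin
  have hconst : ∀ W : ℝ → ℝ, (∀ x ∈ Icc 0 ℓ, HasDerivAt W 0 x) → ∀ x ∈ Icc 0 ℓ, W x = W 0 :=
    fun W hW => constant_of_has_deriv_right_zero
      (fun x hx => (hW x hx).continuousAt.continuousWithinAt)
      (fun x hx => (hW x ⟨hx.1, hx.2.le⟩).hasDerivWithinAt)
  -- The vector `(k G, P)` rotates with angle `k x`; undoing the rotation leaves two constants.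
  have h1 := hconst (fun x => k * G x * Real.cos (k * x) - P x * Real.sin (k * x)) fun x hx => by
    refine ((((hGd x).const_mul k).mul (hcos x)).sub ((hPd x).mul (hsin x))).congr_deriv ?_
    rw [hFf x hx, hGf x hx]; ring
  have h2 := hconst (fun x => k * G x * Real.sin (k * x) + P x * Real.cos (k * x)) fun x hx => by
    refine ((((hGd x).const_mul k).mul (hsin x)).add ((hPd x).mul (hcos x))).congr_deriv ?_
    rw [hFf x hx, hGf x hx]; ring
  intro x hx
  have h0 : (0 : ℝ) ∈ Icc 0 ℓ := ⟨le_rfl, hℓ.le⟩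
  have e1 := h1 x hx
  have e2 := h2 x hx
  simp only [hGf x hx, hGf 0 h0, hPp x hx, hPp 0 h0, mul_zero, Real.cos_zero, Real.sin_zero,
    mul_one, sub_zero, zero_add] at e1 e2
  have hsc := Real.sin_sq_add_cos_sq (k * x)
  constructor
  · field_simp
    linear_combination Real.cos (k * x) * e1 + Real.sin (k * x) * e2 - k * f x * hsc
  · linear_combination Real.cos (k * x) * e2 - Real.sin (k * x) * e1 - p x * hsc

/-! ### Passage between eigenfunctions and vertex data. -/

variable {V E : Type*} [Fintype V] [Fintype E] (Γ : MetricGraph V E)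

/-- The initial point of an edge, as an element of its parametrizing interval. -/
abbrev left (e : E) : Icc (0 : ℝ) (Γ.length e) := ⟨0, le_rfl, (Γ.length_pos e).le⟩

/-- The final point of an edge, as an element of its parametrizing interval. -/
abbrev right (e : E) : Icc (0 : ℝ) (Γ.length e) := ⟨Γ.length e, (Γ.length_pos e).le, le_rfl⟩

lemma onEdge_apply (f : Γ.Point → ℝ) (e : E) (x : Icc (0 : ℝ) (Γ.length e)) :
    Γ.onEdge f e x = f (Γ.pt e x) := by
  rw [onEdge, IccExtend_of_mem _ _ x.2]

/-- A function on the graph takes a well-defined value at every vertex. -/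
lemma exists_vertex_values (f : Γ.Point → ℝ) :
    ∃ F : V → ℝ, ∀ e, f (Γ.pt e (Γ.left e)) = F (Γ.src e) ∧
      f (Γ.pt e (Γ.right e)) = F (Γ.tgt e) := by
  classical
  -- The value 0 concerns only vertices without incident edges, on which nothing is claimed.
  let F : V → ℝ := fun v => if h : ∃ q : Γ.PrePoint, Γ.IsAt q v then f (Quot.mk _ h.choose) else 0
  have hF : ∀ (q : Γ.PrePoint) (v : V), Γ.IsAt q v → f (Quot.mk _ q) = F v := by
    intro q v hq
    have h : ∃ q : Γ.PrePoint, Γ.IsAt q v := ⟨q, hq⟩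
    simp only [F, dif_pos h]
    exact congrArg f (Quot.sound ⟨v, hq, h.choose_spec⟩)
  exact ⟨F, fun e => ⟨hF ⟨e, Γ.left e⟩ _ (Or.inl ⟨rfl, rfl⟩),
    hF ⟨e, Γ.right e⟩ _ (Or.inr ⟨rfl, rfl⟩)⟩⟩

open Classical in
/-- On an equilateral graph with edge length `ℓ`, an eigenfunction for `k²`, `0 < k ℓ < π`, does not
vanish at all vertices, and its vertex values satisfy a discrete eigenvalue equation. -/
lemma IsEigenfunction.exists_discrete {ℓ k : ℝ} (hℓ : ∀ e, Γ.length e = ℓ) (hk : 0 < k)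
    (hs : 0 < Real.sin (k * ℓ)) {f : Γ.Point → ℝ} (hf : Γ.IsEigenfunction (k ^ 2) f) :
    ∃ F : V → ℝ, F ≠ 0 ∧ ∀ v,
      (∑ e with Γ.tgt e = v, (Real.cos (k * ℓ) * F v - F (Γ.src e))) +
        (∑ e with Γ.src e = v, (Real.cos (k * ℓ) * F v - F (Γ.tgt e))) = 0 := by
  obtain ⟨hf0, p, h, ⟨hfp, hph, hK⟩, heq⟩ := hf
  obtain ⟨F, hF⟩ := Γ.exists_vertex_values f
  have hsol := fun e => (hfp e).eq_cos_add_sin (Γ.length_pos e) hk (hph e) (heq e)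
  have hsrc : ∀ e, Γ.onEdge f e 0 = F (Γ.src e) := fun e => by
    exact (Γ.onEdge_apply f e (Γ.left e)).trans (hF e).1
  have htgt : ∀ e, Γ.onEdge f e ℓ = F (Γ.tgt e) := fun e => by
    simpa [hℓ] using (Γ.onEdge_apply f e (Γ.right e)).trans (hF e).2
  have hend := fun e => hsol e _ (Γ.right e).2
  simp only [hℓ, hsrc, htgt] at hend hK
  have hp0 : ∀ e, p e 0 * Real.sin (k * ℓ) =
      -(k * (Real.cos (k * ℓ) * F (Γ.src e) - F (Γ.tgt e))) := fun e => by
    have := (hend e).1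
    field_simp at this
    linear_combination -this
  have hpℓ : ∀ e, p e ℓ * Real.sin (k * ℓ) =
      k * (Real.cos (k * ℓ) * F (Γ.tgt e) - F (Γ.src e)) := fun e => by
    linear_combination Real.sin (k * ℓ) * (hend e).2 + Real.cos (k * ℓ) * hp0 e
      - k * F (Γ.src e) * Real.sin_sq_add_cos_sq (k * ℓ)
  refine ⟨F, fun hF0 => hf0 ?_, fun v => ?_⟩
  · funext y
    obtain ⟨⟨e, x⟩, rfl⟩ := Quot.exists_rep y
    have hpz : p e 0 = 0 := by
      have := hp0 e
      simpa [hF0, hs.ne'] using this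
    have := (hsol e x x.2).1
    rw [Γ.onEdge_apply, hsrc, hpz, hF0] at this
    exact this.trans (show _ = (0 : ℝ) by simp)
  -- This is the Kirchhoff condition times `sin (k ℓ)`, which turns the end derivatives into vertex
  -- values.
  · have hv := congrArg (· * Real.sin (k * ℓ)) (hK v)
    simp only [zero_mul, sub_mul, Finset.sum_mul, hp0, hpℓ] at hv
    rw [Finset.sum_neg_distrib, ← Finset.mul_sum, ← Finset.mul_sum, sub_neg_eq_add, ← mul_add] at hv
    have := (mul_eq_zero.1 hv).resolve_left hk.ne'
    rw [← this]
    congr 1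
    · exact Finset.sum_congr rfl fun e he => by rw [(Finset.mem_filter.1 he).2]
    · exact Finset.sum_congr rfl fun e he => by rw [(Finset.mem_filter.1 he).2]

open Classical in
/-- Trigonometric functions on the edges that match at the vertices and satisfy the Kirchhoff
condition define an eigenfunction. -/
lemma exists_eigenfunction_of_edge_coeffs {ℓ k : ℝ} (hℓ : ∀ e, Γ.length e = ℓ) (hk : 0 < k)
    (A B : E → ℝ) (F : V → ℝ) (hsrc : ∀ e, A e = F (Γ.src e))
    (htgt : ∀ e, A e * Real.cos (k * ℓ) + B e * Real.sin (k * ℓ) = F (Γ.tgt e))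
    (hK : ∀ v, (∑ e with Γ.tgt e = v, (B e * Real.cos (k * ℓ) - A e * Real.sin (k * ℓ))) -
      ∑ e with Γ.src e = v, B e = 0)
    (hAB : ∃ e, A e ≠ 0 ∨ B e ≠ 0) :
    ∃ f : Γ.Point → ℝ, Γ.IsEigenfunction (k ^ 2) f ∧
      ∀ e x, f (Γ.pt e x) = A e * Real.cos (k * x) + B e * Real.sin (k * x) := by
  let φ : E → ℝ → ℝ := fun e x => A e * Real.cos (k * x) + B e * Real.sin (k * x)
  have hat : ∀ (q : Γ.PrePoint) v, Γ.IsAt q v → φ q.1 q.2 = F v := by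
    rintro ⟨e, x⟩ v (⟨hx, rfl⟩ | ⟨hx, rfl⟩)
    · simp only at hx
      simp [φ, hx, hsrc]
    · simp only [hℓ] at hx
      simp only [φ, hx, htgt]
  let f : Γ.Point → ℝ := Quot.lift (fun q : Γ.PrePoint => φ q.1 q.2) (by
    rintro q r ⟨v, hq, hr⟩
    rw [hat q v hq, hat r v hr])
  let p : E → ℝ → ℝ := fun e x => k * (B e * Real.cos (k * x) - A e * Real.sin (k * x))
  have hlin : ∀ x, HasDerivAt (fun y => k * y) k x := fun x => by
    simpa using (hasDerivAt_id x).const_mul k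
  have hφ : ∀ e x, HasDerivAt (φ e) (p e x) x := fun e x => by
    refine (((hlin x).cos.const_mul (A e)).add ((hlin x).sin.const_mul (B e))).congr_deriv ?_
    simp only [p]; ring
  have hp : ∀ e x, HasDerivAt (p e) (-(k ^ 2 * φ e x)) x := fun e x => by
    refine ((((hlin x).cos.const_mul (B e)).sub
      ((hlin x).sin.const_mul (A e))).const_mul k).congr_deriv ?_
    simp only [φ]; ring
  have hedge : ∀ e, ∀ x ∈ Icc 0 (Γ.length e), Γ.onEdge f e x = φ e x :=
    fun e x hx => Γ.onEdge_apply f e ⟨x, hx⟩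
  refine ⟨f, ⟨?_, p, fun e x => -(k ^ 2 * φ e x), ⟨fun e => ?_, fun e => ?_, fun v => ?_⟩,
    fun e => ?_⟩, fun e x => rfl⟩
  · intro hf
    have hzero : ∀ e, ∀ x ∈ Icc 0 (Γ.length e), φ e x = 0 := fun e x hx =>
      congrFun hf (Γ.pt e ⟨x, hx⟩)
    obtain ⟨e, he⟩ := hAB
    have hA : A e = 0 := by simpa [φ] using hzero e 0 (Γ.left e).2
    have hpos := Γ.length_pos e
    -- The endpoint cannot detect `B e` when `sin (k ℓ) = 0`, as for pumpkins. The point `m` lies on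
    -- the edge and has `0 < k m ≤ 1 < π`.
    set m := min (Γ.length e) (1 / k)
    have hm0 : 0 < m := lt_min hpos (by positivity)
    have hm1 : k * m ≤ 1 := by
      calc k * m ≤ k * (1 / k) := by gcongr; exact min_le_right _ _
        _ = 1 := by field_simp
    have hsin : 0 < Real.sin (k * m) :=
      Real.sin_pos_of_pos_of_lt_pi (by positivity) (by linarith [Real.pi_gt_three])
    have hB : B e = 0 := by
      simpa [φ, hA, hsin.ne'] using hzero e m ⟨hm0.le, min_le_left _ _⟩
    tauto
  · exact .of_hasDerivAt (Γ.length_pos e).le (by fun_prop) (hφ e) (hedge e)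
  · exact .of_hasDerivAt (Γ.length_pos e).le (by fun_prop) (hp e) fun _ _ => rfl
  · simp only [p, hℓ, ← Finset.mul_sum, ← mul_sub]
    simpa [Finset.mul_sum, mul_sub] using congrArg (k * ·) (hK v)
  · filter_upwards [ae_restrict_mem measurableSet_Icc] with x hx
    rw [neg_neg, hedge e x hx]

/-! ### Criteria for hot spots and for `μ₂`. -/

lemma cos_add_sin_le_one {A B : ℝ} (h : A ^ 2 + B ^ 2 ≤ 1) (y : ℝ) :
    A * Real.cos y + B * Real.sin y ≤ 1 := by
  nlinarith [sq_nonneg (A - Real.cos y), sq_nonneg (B - Real.sin y), Real.sin_sq_add_cos_sq y]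

/-- It suffices to find, for every point, an eigenfunction whose global maximum `1` is attained
there. -/
lemma hotSpots_eq_univ_of_forall {μ : ℝ} (hμ : Γ.IsMuTwo μ)
    (h : ∀ x, ∃ ψ, Γ.IsEigenfunction μ ψ ∧ ψ x = 1 ∧ ∀ y, ψ y ≤ 1) :
    Γ.hotSpots = Γ.localHotSpots ∧ Γ.localHotSpots = univ := by
  have h1 : Γ.hotSpots = univ := eq_univ_of_forall fun x => by
    obtain ⟨ψ, hψ, hx, hmax⟩ := h x
    exact ⟨μ, ψ, hμ, hψ, fun y => hx ▸ hmax y⟩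
  have h2 : Γ.localHotSpots = univ := eq_univ_of_forall fun x => by
    obtain ⟨ψ, hψ, hx, hmax⟩ := h x
    exact ⟨μ, ψ, hμ, hψ, by simp [hx], 1, one_pos, fun y _ => hx ▸ hmax y⟩
  exact ⟨h1.trans h2.symm, h2⟩

lemma isMuTwo_sq {k : ℝ} (hk : 0 < k) (hex : ∃ f, Γ.IsEigenfunction (k ^ 2) f)
    (hmin : ∀ j f, 0 < j → j < k → ¬ Γ.IsEigenfunction (j ^ 2) f) : Γ.IsMuTwo (k ^ 2) := by
  refine ⟨⟨by positivity, hex⟩, ?_⟩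
  rintro lam ⟨hlam, f, hf⟩
  by_contra! hlt
  refine hmin (Real.sqrt lam) f (Real.sqrt_pos.2 hlam) ?_ (by rwa [Real.sq_sqrt hlam.le])
  exact (Real.sqrt_lt' hk).2 hlt

/-! ### Pumpkin graphs. -/

open Classical in
/-- In a pumpkin graph the sum over the edges at a vertex runs over all edges. -/
lemma IsPumpkin.sum_incident {v₁ v₂ : V} (hne : v₁ ≠ v₂) (hconn : ∀ e, Γ.Connects e v₁ v₂)
    (a b : E → ℝ) :
    (∑ e with Γ.tgt e = v₁, a e) + (∑ e with Γ.src e = v₁, b e) =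
      ∑ e, if Γ.tgt e = v₁ then a e else b e := by
  rw [Finset.sum_filter, Finset.sum_filter, ← Finset.sum_add_distrib]
  refine Finset.sum_congr rfl fun e _ => ?_
  rcases hconn e with ⟨h1, h2⟩ | ⟨h1, h2⟩ <;> simp [h1, h2, hne.symm]

/-- All edges contribute equally to the discrete equation at a vertex, so `cos (k ℓ)` times either
vertex value is the other one. Hence `sin² (k ℓ)` annihilates both. -/
lemma IsPumpkin.not_isEigenfunction (h : Γ.IsPumpkin) {ℓ k : ℝ} (hℓ : ∀ e, Γ.length e = ℓ)
    (hk : 0 < k) (hlt : k * ℓ < Real.pi) (f : Γ.Point → ℝ) : ¬ Γ.IsEigenfunction (k ^ 2) f := by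
  classical
  intro hf
  obtain ⟨v₁, v₂, hne, hall, hconn⟩ := h
  obtain ⟨e₀⟩ := Γ.nonempty_edges
  have hkl : 0 < k * ℓ := mul_pos hk (hℓ e₀ ▸ Γ.length_pos e₀)
  have hs := Real.sin_pos_of_pos_of_lt_pi hkl hlt
  obtain ⟨F, hF0, hF⟩ := hf.exists_discrete Γ hℓ hk hs
  have key : ∀ u w, u ≠ w → (∀ e, Γ.Connects e u w) → Real.cos (k * ℓ) * F u - F w = 0 := by
    intro u w huw hc
    have := hF u
    rw [IsPumpkin.sum_incident Γ huw hc] at this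
    have hcongr : ∀ e, (if Γ.tgt e = u then Real.cos (k * ℓ) * F u - F (Γ.src e)
        else Real.cos (k * ℓ) * F u - F (Γ.tgt e)) = Real.cos (k * ℓ) * F u - F w := fun e => by
      rcases hc e with ⟨h1, h2⟩ | ⟨h1, h2⟩ <;> simp [h1, h2, huw.symm]
    simp only [hcongr, Finset.sum_const, nsmul_eq_mul] at this
    refine (mul_eq_zero.1 this).resolve_left ?_
    exact Nat.cast_ne_zero.2 (Finset.card_ne_zero_of_mem (Finset.mem_univ e₀))
  have h1 := key v₁ v₂ hne hconn
  have h2 := key v₂ v₁ hne.symm fun e => (hconn e).symm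
  have hsc := Real.sin_sq_add_cos_sq (k * ℓ)
  have hz : ∀ y z : ℝ, Real.cos (k * ℓ) * y - z = 0 → Real.cos (k * ℓ) * z - y = 0 → y = 0 := by
    intro y z hy hz
    have : Real.sin (k * ℓ) ^ 2 * y = 0 := by
      linear_combination hsc * y - Real.cos (k * ℓ) * hy - hz
    exact (mul_eq_zero.1 this).resolve_left (by positivity)
  refine hF0 (funext fun v => ?_)
  rcases hall v with rfl | rfl
  · exact hz _ _ h1 h2
  · exact hz _ _ h2 h1

/-- At `k ℓ = π` the cosine part changes sign along each edge. The sine part vanishes at both ends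
and is symmetric under reversal, so orientations are irrelevant and Kirchhoff's condition becomes `∑
B e = 0`. -/
lemma IsPumpkin.exists_eigenfunction (h : Γ.IsPumpkin) (hE : 2 ≤ Fintype.card E) {ℓ k : ℝ}
    (hℓ : ∀ e, Γ.length e = ℓ) (hk : 0 < k) (hkl : k * ℓ = Real.pi) (x : Γ.Point) :
    ∃ ψ, Γ.IsEigenfunction (k ^ 2) ψ ∧ ψ x = 1 ∧ ∀ y, ψ y ≤ 1 := by
  classical
  obtain ⟨v₁, v₂, hne, hall, hconn⟩ := h
  obtain ⟨⟨e₀, t⟩, rfl⟩ := Quot.exists_rep x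
  set C := Real.cos (k * t)
  set S := Real.sin (k * t)
  have hCS : S ^ 2 + C ^ 2 = 1 := Real.sin_sq_add_cos_sq _
  set n : ℝ := (Fintype.card E : ℝ) - 1 with hn
  have hn1 : 1 ≤ n := by
    have : (2 : ℝ) ≤ Fintype.card E := by exact_mod_cast hE
    linarith
  let F : V → ℝ := fun v => if v = Γ.src e₀ then C else -C
  -- The coefficient `S` on `e₀` is balanced evenly by the `n ≥ 1` other edges, none of which gets a
  -- larger amplitude.
  let B : E → ℝ := fun e => if e = e₀ then S else -S / n
  have hneg : ∀ e, -F (Γ.src e) = F (Γ.tgt e) := by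
    intro e
    rcases hconn e with ⟨h1, h2⟩ | ⟨h1, h2⟩ <;> rcases hconn e₀ with ⟨h3, h4⟩ | ⟨h3, h4⟩ <;>
      simp [F, h1, h2, h3, hne, hne.symm]
  have hB : ∑ e, B e = 0 := by
    rw [← Finset.add_sum_erase _ _ (Finset.mem_univ e₀),
      Finset.sum_congr rfl (g := fun _ => -S / n) fun e he => by
        simp [B, Finset.ne_of_mem_erase he]]
    rw [Finset.sum_const, Finset.card_erase_of_mem (Finset.mem_univ _), Finset.card_univ,
      nsmul_eq_mul, Nat.cast_sub (by omega), Nat.cast_one, ← hn]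
    simp only [B, if_true]
    field_simp
    ring
  have hsq : ∀ e, F (Γ.src e) ^ 2 + B e ^ 2 ≤ 1 := by
    intro e
    have h1 : F (Γ.src e) ^ 2 = C ^ 2 := by
      simp only [F]; split_ifs <;> ring
    have h2 : B e ^ 2 ≤ S ^ 2 := by
      simp only [B]
      split_ifs
      · exact le_rfl
      · rw [div_pow, neg_sq]
        exact div_le_self (sq_nonneg S) (one_le_pow₀ hn1)
    linarith
  obtain ⟨f, hf, hval⟩ := Γ.exists_eigenfunction_of_edge_coeffs hℓ hk (fun e => F (Γ.src e)) B F
    (fun e => rfl) (fun e => by simp [hkl, hneg]) (fun v => by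
      have key : ∀ u w, u ≠ w → (∀ e, Γ.Connects e u w) →
          (∑ e with Γ.tgt e = u, B e) + (∑ e with Γ.src e = u, B e) = 0 := fun u w huw hc => by
        rw [IsPumpkin.sum_incident Γ huw hc]
        simpa using hB
      have hv : (∑ e with Γ.tgt e = v, B e) + (∑ e with Γ.src e = v, B e) = 0 := by
        rcases hall v with rfl | rfl
        · exact key v v₂ hne hconn
        · exact key v v₁ hne.symm fun e => (hconn e).symm
      simp only [hkl, Real.cos_pi, Real.sin_pi, mul_neg_one, mul_zero, sub_zero,
        Finset.sum_neg_distrib]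
      linarith) ⟨e₀, by
        by_contra! hcon
        simp only [F, B, if_true] at hcon
        simp [hcon.1, hcon.2] at hCS⟩
  refine ⟨f, hf, ?_, fun y => ?_⟩
  · refine (hval e₀ t).trans ?_
    simp only [F, B, if_true]
    linear_combination hCS
  · obtain ⟨⟨e, y⟩, rfl⟩ := Quot.exists_rep y
    exact (hval e y).trans_le (cos_add_sin_le_one (hsq e) _)

/-! ### Complete graphs. -/

open Classical in
/-- In a complete graph the edges at a vertex correspond to the other vertices. -/
lemma IsComplete.sum_incident (h : Γ.IsComplete) (v : V) (g : V → ℝ) :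
    (∑ e with Γ.tgt e = v, g (Γ.src e)) + (∑ e with Γ.src e = v, g (Γ.tgt e)) =
      (∑ u, g u) - g v := by
  have hu : ∀ u, (∑ e, if Γ.Connects e v u then g u else 0) = if u = v then 0 else g u := by
    intro u
    split_ifs with huv
    · refine Finset.sum_eq_zero fun e _ => if_neg ?_
      rintro (⟨h1, h2⟩ | ⟨h1, h2⟩) <;> exact h.2 e (by rw [h1, h2, huv])
    · obtain ⟨e, he, huniq⟩ := h.1 v u (Ne.symm huv)
      rw [Finset.sum_eq_single e (fun e' _ hne => if_neg fun hc => hne (huniq e' hc)) (by simp),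
        if_pos he]
  have hR : (∑ u, g u) - g v = ∑ u, ∑ e, if Γ.Connects e v u then g u else 0 := by
    simp only [hu]
    rw [← Finset.add_sum_erase _ _ (Finset.mem_univ v),
      ← Finset.add_sum_erase _ (fun u => if u = v then 0 else g u) (Finset.mem_univ v), if_pos rfl,
      zero_add, add_sub_cancel_left]
    exact Finset.sum_congr rfl fun u hu => (if_neg (Finset.ne_of_mem_erase hu)).symm
  rw [hR, Finset.sum_comm, Finset.sum_filter, Finset.sum_filter, ← Finset.sum_add_distrib]
  refine Finset.sum_congr rfl fun e _ => ?_
  have hloop := h.2 e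
  by_cases h1 : Γ.src e = v
  · have h2 : Γ.tgt e ≠ v := fun h2 => hloop (h1.trans h2.symm)
    simp [Connects, h1, h2]
  · by_cases h2 : Γ.tgt e = v <;> simp [Connects, h1, h2]

/-- With `n` vertices and `c = cos (k ℓ)`, the discrete equation is `((n-1)c + 1) F v = ∑ F`.
Summing over `v` gives `(n-1)(c-1) ∑ F = 0`, so `∑ F = 0` as `c < 1`; then `F = 0` as `c >
-1/(n-1)`. -/
lemma IsComplete.not_isEigenfunction (h : Γ.IsComplete) (hV : 3 ≤ Fintype.card V) {ℓ k : ℝ}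
    (hℓ : ∀ e, Γ.length e = ℓ) (hk : 0 < k)
    (hlt : k * ℓ < Real.arccos (-(1 / ((Fintype.card V : ℝ) - 1)))) (f : Γ.Point → ℝ) :
    ¬ Γ.IsEigenfunction (k ^ 2) f := by
  classical
  intro hf
  have hn : (3 : ℝ) ≤ Fintype.card V := by exact_mod_cast hV
  obtain ⟨e₀⟩ := Γ.nonempty_edges
  have hkl : 0 < k * ℓ := mul_pos hk (hℓ e₀ ▸ Γ.length_pos e₀)
  have hpi := hlt.trans_le (Real.arccos_le_pi _)
  obtain ⟨F, hF0, hF⟩ := hf.exists_discrete Γ hℓ hk (Real.sin_pos_of_pos_of_lt_pi hkl hpi)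
  set c := Real.cos (k * ℓ)
  set n : ℝ := (Fintype.card V : ℝ) with hndef
  have hc1 : c < 1 := by
    rw [← Real.cos_zero]
    exact Real.cos_lt_cos_of_nonneg_of_le_pi le_rfl hpi.le hkl
  have hinv : 1 / (n - 1) ≤ 1 := by
    rw [div_le_one (by linarith)]; linarith
  have hinv0 : 0 ≤ 1 / (n - 1) := div_nonneg zero_le_one (by linarith)
  have hc2 : 0 < (n - 1) * c + 1 := by
    have : -(1 / (n - 1)) < c := by
      rw [← Real.cos_arccos (x := -(1 / (n - 1))) (by linarith) (by linarith)]
      exact Real.cos_lt_cos_of_nonneg_of_le_pi hkl.le (Real.arccos_le_pi _) hlt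
    have h3 : (n - 1) * -(1 / (n - 1)) < (n - 1) * c :=
      mul_lt_mul_of_pos_left this (by linarith)
    have h4 : (n - 1) * -(1 / (n - 1)) = -1 := by
      have : n - 1 ≠ 0 := by linarith
      field_simp
    linarith
  have key : ∀ v, ((n - 1) * c + 1) * F v = ∑ u, F u := by
    intro v
    have := h.sum_incident Γ v (fun u => c * F v - F u)
    rw [hF v, Finset.sum_sub_distrib, Finset.sum_const, nsmul_eq_mul, Finset.card_univ,
      ← hndef] at this
    linear_combination -this
  have hsum : ∑ u, F u = 0 := by
    have := Finset.sum_congr (rfl : (Finset.univ : Finset V) = _) fun v _ => key v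
    rw [← Finset.mul_sum, Finset.sum_const, nsmul_eq_mul, Finset.card_univ, ← hndef] at this
    have h2 : ((n - 1) * (c - 1)) * ∑ u, F u = 0 := by linear_combination this
    exact (mul_eq_zero.1 h2).resolve_left (mul_ne_zero (by linarith) (by linarith))
  refine hF0 (funext fun v => ?_)
  have := key v
  rw [hsum] at this
  exact (mul_eq_zero.1 this).resolve_left hc2.ne'

/-- The vertex values of the eigenfunction peaking on an edge with end values `a`, `b`, the other
vertices sharing the value `-(a + b) / (n - 2)`, `c = 1 / (n - 1)`. -/
lemma edge_form_le {a b c w : ℝ} (hc : c ≤ 1 / 2) (hab : a ^ 2 + b ^ 2 + 2 * c * a * b = 1 - c ^ 2)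
    (hw : (1 - c) * w = -(c * (a + b))) : a ^ 2 + w ^ 2 + 2 * c * a * w ≤ 1 - c ^ 2 := by
  -- Eliminating `w` leaves a square times `1 - 2c`, which is where `c ≤ 1/2` enters.
  have h1 : (1 - c) ^ 2 * (a ^ 2 + w ^ 2 + 2 * c * a * w - (1 - c ^ 2)) =
      -((a * c + b) ^ 2 * (1 - 2 * c)) := by
    linear_combination ((1 - c) * w - c * (a + b) + 2 * c * a * (1 - c)) * hw + (1 - c) ^ 2 * hab
  have h2 : 0 ≤ (a * c + b) ^ 2 * (1 - 2 * c) := mul_nonneg (sq_nonneg _) (by linarith)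
  have h3 : 0 < (1 - c) ^ 2 := by
    have : 0 < 1 - c := by linarith
    positivity
  by_contra! hcon
  have := mul_pos h3 (sub_pos.2 hcon)
  linarith

/-- Under the constraint `hab`, `(a + b)²` is at most `2(1 - c)`, with equality at `a = b`. The
claim then reduces to `4c² ≤ (1 - c)²`, that is, to `c ≤ 1/3`. -/
lemma far_edge_form_le {a b c w : ℝ} (hc0 : 0 < c) (hc : c ≤ 1 / 3)
    (hab : a ^ 2 + b ^ 2 + 2 * c * a * b = 1 - c ^ 2) (hw : (1 - c) * w = -(c * (a + b))) :
    w ^ 2 + w ^ 2 + 2 * c * w * w ≤ 1 - c ^ 2 := by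
  have hs : (a + b) ^ 2 ≤ 2 * (1 - c) := by
    have h0 : 0 ≤ (1 - c) * (a - b) ^ 2 := mul_nonneg (by linarith) (sq_nonneg _)
    have h1 : (1 + c) * (a + b) ^ 2 ≤ (1 + c) * (2 * (1 - c)) := by linarith
    exact le_of_mul_le_mul_left h1 (by linarith)
  have h1 : (1 - c) ^ 2 * w ^ 2 = c ^ 2 * (a + b) ^ 2 := by
    linear_combination ((1 - c) * w - c * (a + b)) * hw
  have h2 : (1 - c) * ((1 - c) * w ^ 2) ≤ (1 - c) * (2 * c ^ 2) := by
    have := mul_le_mul_of_nonneg_left hs (sq_nonneg c)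
    linarith
  have h3 : (1 - c) * w ^ 2 ≤ 2 * c ^ 2 := le_of_mul_le_mul_left h2 (by linarith)
  have h4 : (1 - c) * (2 * w ^ 2) ≤ (1 - c) * (1 - c) := by nlinarith
  have h5 : 2 * w ^ 2 ≤ 1 - c := le_of_mul_le_mul_left h4 (by linarith)
  have := mul_le_mul_of_nonneg_left h5 (by linarith : (0 : ℝ) ≤ 1 + c)
  linarith

/-- At this `k`, any nonzero vertex values with sum zero extend to an eigenfunction. If an edge has
end values `a`, `b`, its squared amplitude is `(a² + b² + 2cab)/(1 - c²)`, so the two quadratic form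
estimates bound it by 1. -/
lemma IsComplete.exists_eigenfunction (h : Γ.IsComplete) (hV : 3 ≤ Fintype.card V) {ℓ k : ℝ}
    (hℓ : ∀ e, Γ.length e = ℓ) (hk : 0 < k)
    (hkl : k * ℓ = Real.arccos (-(1 / ((Fintype.card V : ℝ) - 1)))) (x : Γ.Point) :
    ∃ ψ, Γ.IsEigenfunction (k ^ 2) ψ ∧ ψ x = 1 ∧ ∀ y, ψ y ≤ 1 := by
  classical
  obtain ⟨⟨e₀, t⟩, rfl⟩ := Quot.exists_rep x
  have hn : (3 : ℝ) ≤ Fintype.card V := by exact_mod_cast hV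
  set n : ℝ := (Fintype.card V : ℝ) with hndef
  set c : ℝ := 1 / (n - 1) with hcdef
  have hc0 : 0 < c := by rw [hcdef]; exact div_pos one_pos (by linarith)
  have hcn : c * (n - 1) = 1 := by
    rw [hcdef]; exact div_mul_cancel₀ _ (by linarith)
  have hc2 : c ≤ 1 / 2 := by nlinarith
  have hcos : Real.cos (k * ℓ) = -c := by
    rw [hkl]; exact Real.cos_arccos (by linarith) (by linarith)
  set s := Real.sin (k * ℓ) with hsdef
  have hs2 : s ^ 2 = 1 - c ^ 2 := by
    have := Real.sin_sq_add_cos_sq (k * ℓ)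
    rw [hcos] at this
    linarith
  have hs : 0 < s := by
    rw [hsdef, hkl, Real.sin_arccos]
    exact Real.sqrt_pos.2 (by nlinarith)
  set C := Real.cos (k * t)
  set S := Real.sin (k * t)
  have hCS : S ^ 2 + C ^ 2 = 1 := Real.sin_sq_add_cos_sq _
  -- The value of `cos (k (x - t))` at the end `x = ℓ` of `e₀`.
  set b := -c * C + s * S with hb
  have hab : C ^ 2 + b ^ 2 + 2 * c * C * b = 1 - c ^ 2 := by
    rw [hb]
    linear_combination (S ^ 2) * hs2 + (1 - c ^ 2) * hCS
  have hba : b ^ 2 + C ^ 2 + 2 * c * b * C = 1 - c ^ 2 := by linear_combination hab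
  -- The common value at the other `n - 2 ≥ 1` vertices that makes the total zero.
  set w := -(C + b) / (n - 2) with hwdef
  have hwn : (n - 2) * w = -(C + b) := by
    rw [hwdef]; exact mul_div_cancel₀ _ (by linarith)
  have hw : (1 - c) * w = -(c * (C + b)) := by
    linear_combination c * hwn - w * hcn
  have hw' : (1 - c) * w = -(c * (b + C)) := by linear_combination hw
  let F : V → ℝ := fun v => if v = Γ.src e₀ then C else if v = Γ.tgt e₀ then b else w
  have hne₀ : Γ.src e₀ ≠ Γ.tgt e₀ := h.2 e₀
  have hFs : F (Γ.src e₀) = C := by simp [F]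
  have hFt : F (Γ.tgt e₀) = b := by simp [F, hne₀.symm]
  have hFw : ∀ v, v ≠ Γ.src e₀ → v ≠ Γ.tgt e₀ → F v = w := fun v h1 h2 => by simp [F, h1, h2]
  have hsum : ∑ v, F v = 0 := by
    have hmem : Γ.tgt e₀ ∈ Finset.univ.erase (Γ.src e₀) := by simp [hne₀.symm]
    rw [← Finset.add_sum_erase _ _ (Finset.mem_univ (Γ.src e₀)), ← Finset.add_sum_erase _ _ hmem,
      Finset.sum_congr rfl (g := fun _ => w) fun v hv => by
        simp only [Finset.mem_erase] at hv
        exact hFw v hv.2.1 hv.1,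
      Finset.sum_const, Finset.card_erase_of_mem hmem,
      Finset.card_erase_of_mem (Finset.mem_univ _), Finset.card_univ, nsmul_eq_mul, hFs, hFt,
      Nat.sub_sub, Nat.cast_sub (by omega), ← hndef]
    push_cast
    linear_combination hwn
  let B : E → ℝ := fun e => (F (Γ.tgt e) + c * F (Γ.src e)) / s
  have hB : ∀ e, B e * s = F (Γ.tgt e) + c * F (Γ.src e) := fun e => div_mul_cancel₀ _ hs.ne'
  have hform : ∀ e, F (Γ.src e) ^ 2 + F (Γ.tgt e) ^ 2 + 2 * c * F (Γ.src e) * F (Γ.tgt e)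
      ≤ 1 - c ^ 2 := by
    intro e
    have hloop := h.2 e
    by_cases h1 : Γ.src e = Γ.src e₀
    · rw [h1, hFs]
      by_cases h2 : Γ.tgt e = Γ.tgt e₀
      · rw [h2, hFt]; exact hab.le
      · rw [hFw _ (fun h3 => hloop (h1.trans h3.symm)) h2]
        exact edge_form_le hc2 hab hw
    by_cases h2 : Γ.src e = Γ.tgt e₀
    · rw [h2, hFt]
      by_cases h3 : Γ.tgt e = Γ.src e₀
      · rw [h3, hFs]; exact hba.le
      · rw [hFw _ h3 (fun h4 => hloop (h2.trans h4.symm))]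
        exact edge_form_le hc2 hba hw'
    rw [hFw _ h1 h2]
    by_cases h3 : Γ.tgt e = Γ.src e₀
    · rw [h3, hFs]
      have := edge_form_le hc2 hab hw
      linarith
    by_cases h4 : Γ.tgt e = Γ.tgt e₀
    · rw [h4, hFt]
      have := edge_form_le hc2 hba hw'
      linarith
    rw [hFw _ h3 h4]
    refine far_edge_form_le hc0 ?_ hab hw
    -- An edge disjoint from `e₀` forces four distinct vertices, so `n ≥ 4` and `c ≤ 1/3`.
    have hcard : ({Γ.src e, Γ.tgt e, Γ.src e₀, Γ.tgt e₀} : Finset V).card = 4 := by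
      rw [Finset.card_insert_of_notMem (by simp [hloop, h1, h2]),
        Finset.card_insert_of_notMem (by simp [h3, h4]), Finset.card_pair hne₀]
    have h4V : (4 : ℝ) ≤ n := by
      have := Finset.card_le_univ ({Γ.src e, Γ.tgt e, Γ.src e₀, Γ.tgt e₀} : Finset V)
      rw [hcard] at this
      rw [hndef]
      exact_mod_cast this
    nlinarith
  have hsq : ∀ e, F (Γ.src e) ^ 2 + B e ^ 2 ≤ 1 := by
    intro e
    have h1 : s ^ 2 * (F (Γ.src e) ^ 2 + B e ^ 2) ≤ s ^ 2 * 1 := by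
      have h2 : s ^ 2 * (F (Γ.src e) ^ 2 + B e ^ 2) = F (Γ.src e) ^ 2 + F (Γ.tgt e) ^ 2 +
          2 * c * F (Γ.src e) * F (Γ.tgt e) := by
        linear_combination (B e * s + F (Γ.tgt e) + c * F (Γ.src e)) * hB e +
          F (Γ.src e) ^ 2 * hs2
      rw [h2, hs2, mul_one]
      exact hform e
    exact le_of_mul_le_mul_left h1 (by positivity)
  have hB₀ : B e₀ = S := by
    refine mul_right_cancel₀ hs.ne' ?_
    rw [hB, hFs, hFt, hb]; ring
  obtain ⟨f, hf, hval⟩ := Γ.exists_eigenfunction_of_edge_coeffs hℓ hk (fun e => F (Γ.src e)) B F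
    (fun e => rfl) (fun e => by rw [hcos, hB]; ring) (fun v => by
      -- Up to the factor `k`, the derivative towards `v` along the edge from `u` is `(-c F v - F
      -- u)/s`. Since `∑ F = 0`, these add up to `(1 - (n-1)c) F v / s = 0`.
      have hinc := h.sum_incident Γ v (fun u => (-c * F v - F u) / s)
      have ht : ∑ e with Γ.tgt e = v, (B e * Real.cos (k * ℓ) - F (Γ.src e) * s) =
          ∑ e with Γ.tgt e = v, (-c * F v - F (Γ.src e)) / s :=
        Finset.sum_congr rfl fun e he => by
          rw [eq_div_iff hs.ne', ← (Finset.mem_filter.1 he).2, hcos]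
          linear_combination -c * hB e - F (Γ.src e) * hs2
      have hs' : ∑ e with Γ.src e = v, B e =
          -∑ e with Γ.src e = v, (-c * F v - F (Γ.tgt e)) / s := by
        rw [← Finset.sum_neg_distrib]
        refine Finset.sum_congr rfl fun e he => ?_
        rw [← (Finset.mem_filter.1 he).2]
        simp only [B]
        ring
      rw [ht, hs', sub_neg_eq_add, hinc, ← Finset.sum_div, Finset.sum_sub_distrib, hsum,
        Finset.sum_const, nsmul_eq_mul, Finset.card_univ, ← hndef, ← sub_div]
      refine div_eq_zero_iff.2 (Or.inl ?_)
      linear_combination -F v * hcn) ⟨e₀, by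
        by_contra! hcon
        rw [hB₀, hFs] at hcon
        simp [hcon.1, hcon.2] at hCS⟩
  refine ⟨f, hf, ?_, fun y => ?_⟩
  · refine (hval e₀ t).trans ?_
    rw [hB₀, hFs]
    linear_combination hCS
  · obtain ⟨⟨e, y⟩, rfl⟩ := Quot.exists_rep y
    exact (hval e y).trans_le (cos_add_sin_le_one (hsq e) _)

end MetricGraph

/-! ### The main theorem. -/

theorem proposition4p1 {V E : Type*} [Fintype V] [Fintype E] (Γ : MetricGraph V E)
    (hequi : Γ.IsEquilateral)
    (hΓ : (Γ.IsPumpkin ∧ 2 ≤ Fintype.card E) ∨ (Γ.IsComplete ∧ 3 ≤ Fintype.card V)) :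
    Γ.hotSpots = Γ.localHotSpots ∧ Γ.localHotSpots = Set.univ := by
  obtain ⟨ℓ, hℓ⟩ := hequi
  obtain ⟨e₀⟩ := Γ.nonempty_edges
  have hpos : 0 < ℓ := hℓ e₀ ▸ Γ.length_pos e₀
  -- The two families differ only in `θ`, the value of `k ℓ` at the first positive eigenvalue.
  obtain ⟨θ, hθ, hex, hmin⟩ : ∃ θ : ℝ, 0 < θ ∧
      (∀ k, 0 < k → k * ℓ = θ → ∀ x, ∃ ψ, Γ.IsEigenfunction (k ^ 2) ψ ∧ ψ x = 1 ∧ ∀ y, ψ y ≤ 1) ∧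
      ∀ k, 0 < k → k * ℓ < θ → ∀ f, ¬ Γ.IsEigenfunction (k ^ 2) f := by
    rcases hΓ with ⟨h, hE⟩ | ⟨h, hV⟩
    · exact ⟨Real.pi, Real.pi_pos, fun k hk hkl => h.exists_eigenfunction Γ hE hℓ hk hkl,
        fun k hk hkl => h.not_isEigenfunction Γ hℓ hk hkl⟩
    · refine ⟨Real.arccos (-(1 / ((Fintype.card V : ℝ) - 1))), Real.arccos_pos.2 ?_,
        fun k hk hkl => h.exists_eigenfunction Γ hV hℓ hk hkl,
        fun k hk hkl => h.not_isEigenfunction Γ hV hℓ hk hkl⟩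
      have hn : (3 : ℝ) ≤ Fintype.card V := by exact_mod_cast hV
      have : 0 ≤ 1 / ((Fintype.card V : ℝ) - 1) := div_nonneg zero_le_one (by linarith)
      linarith
  have hk : 0 < θ / ℓ := div_pos hθ hpos
  have hkl : θ / ℓ * ℓ = θ := div_mul_cancel₀ _ hpos.ne'
  have hspot := hex (θ / ℓ) hk hkl
  obtain ⟨ψ, hψ, -⟩ := hspot (Γ.pt e₀ (Γ.left e₀))
  refine Γ.hotSpots_eq_univ_of_forall (Γ.isMuTwo_sq hk ⟨ψ, hψ⟩ fun j f hj hjk => ?_) hspot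
  exact hmin j hj (hkl ▸ mul_lt_mul_of_pos_right hjk hpos) f
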